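/- Let $d,m\in\mathbb{N}$, let $A$ be a $d\times d$ matrix with entries in $\{0,1\}$, let $X=X_A$ be the set of all one-sided sequences $x=(x_k)_{k\ge 1}$ over an alphabet of $d$ letters with $A_{x_k,x_{k+1}}=1$ for all $k\ge 1$, with the product topology, and let $f:X\to X$, $f(x)_k=x_{k+1}$, be the corresponding subshift of finite type. Suppose that $f$ is topologically transitive, i.e. for all non-empty open sets $U,V\subset X$ there is $n$ with $f^n(U)\cap V\neq\emptyset$. Let $0<\theta<1$ and suppose that the distance $d_\theta:X\times X\to\mathbb{R}$, $d_\theta(x,y)=\theta^{\min\{k\ge 1:\,x_k\ne y_k\}}$ for $x\neq y$, $d_\theta(x,x)=0$, is computable. Let $\Phi=(\Phi_1,\dots,\Phi_m):X\to\mathbb{R}^m$ be continuous and computable. Then the rotation set $$\mathrm{Rot}(\Phi)=\Big\{\Big(\int\Phi_1\,d\mu,\dots,\int\Phi_m\,d\mu\Big):\ \mu \text{ an } f\text{-invariant Borel probability measure on } X\Big\}$$ is compact and computable. Here an oracle for $x\in X$ is the function $k\mapsto x_k$, and an oracle for a pair $(x,y)\in X\times X$ is the function $k\mapsto(x_k,y_k)$.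 A function $F$ on $X$ or on $X\times X$ with values in a Euclidean space $\mathbb{R}^m$ (or in $\mathbb{R}$) is computable if there is one oracle machine that, for every point $p$ of the domain, given an oracle for $p$ and a number $n\in\mathbb{N}$, halts and outputs a rational point $q$ with $\|q-F(p)\|<2^{-n}$. A compact set $S\subset\mathbb{R}^m$ is computable if there is a Turing machine that on input $n\in\mathbb{N}$ outputs a finite list of pairs $(q_i,l_i)$ with $q_i\in\mathbb{Q}^m$ and $l_i\in\mathbb{Z}$ such that the Hausdorff distance between $\bigcup_i\overline{B}(q_i,2^{-l_i})$ and $S$ is less than $2^{-n}$. -/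

import Mathlib

open MeasureTheory Set

/-! ### Oracle machines -/

/-- Programs of an oracle machine: programs for partial recursive functions of one natural number,
with one further instruction `oracle` that queries the oracle. -/
inductive OracleCode : Type
  | zero : OracleCode
  | succ : OracleCode
  | left : OracleCode
  | right : OracleCode
  | oracle : OracleCode
  | pair : OracleCode → OracleCode → OracleCode
  | comp : OracleCode → OracleCode → OracleCode
  | prec : OracleCode → OracleCode → OracleCode
  | rfind : OracleCode → OracleCode

/-- The partial function computed by a program with access to the oracle `φ`. Apart from the
clause for `oracle`, this is the usual semantics of partial recursive functions, with tuples coded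
by `Nat.pair`. The oracles used below are total functions `ℕ → ℕ`. -/
def OracleCode.eval (φ : ℕ →. ℕ) : OracleCode → ℕ →. ℕ
  | zero => fun _ => Part.some 0
  | succ => fun n => Part.some (n + 1)
  | left => fun n => Part.some n.unpair.1
  | right => fun n => Part.some n.unpair.2
  | oracle => φ
  | pair f g => fun n => Nat.pair <$> eval φ f n <*> eval φ g n
  | comp f g => fun n => eval φ g n >>= eval φ f
  | prec f g => fun p =>
      Nat.rec (eval φ f p.unpair.1)
        (fun y ih => do
          let i ← ih
          eval φ g (Nat.pair p.unpair.1 (Nat.pair y i)))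
        p.unpair.2
  | rfind f => fun a => Nat.rfind fun n => (fun m => decide (m = 0)) <$> eval φ f (Nat.pair a n)

/-! ### Computable functions and computable compact sets

A dense sequence in the metric space `Y` is given by a map `t : C → Y` on a type `C` of codes with
a standard numbering (`Primcodable C`). -/

/-- `F : X → Y` is computable, where `IsOracle φ x` says that `φ` is an oracle for the point `x`:
one and the same oracle machine, given any oracle for any `x` and a number `n`, halts and returns
(the number of) a code `q` such that `t q` is at distance less than `2⁻ⁿ` from `F x`. -/
def IsComputableMap {X C Y : Type*} [Primcodable C] [PseudoMetricSpace Y]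
    (IsOracle : (ℕ → ℕ) → X → Prop) (t : C → Y) (F : X → Y) : Prop :=
  ∃ c : OracleCode, ∀ (φ : ℕ → ℕ) (x : X), IsOracle φ x → ∀ n : ℕ,
    ∃ q : C, Encodable.encode q ∈ c.eval (φ : ℕ →. ℕ) n ∧ dist (t q) (F x) < (1 / 2 : ℝ) ^ n

/-- A computable compact set `S`: there is an algorithm that returns, for each `n`, a finite list
of pairs `(q, l)` such that the union of the closed balls with centre `t q` and radius `2⁻ˡ` has
Hausdorff distance less than `2⁻ⁿ` to `S`. -/
def IsComputableCompact {C Y : Type*} [Primcodable C] [PseudoMetricSpace Y]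
    (t : C → Y) (S : Set Y) : Prop :=
  IsCompact S ∧ ∃ ψ : ℕ → List (C × ℤ), Computable ψ ∧ ∀ n : ℕ,
    Metric.hausdorffEDist (⋃ p ∈ ψ n, Metric.closedBall (t p.1) ((2 : ℝ) ^ (-p.2))) S
      < ENNReal.ofReal ((1 / 2 : ℝ) ^ n)

/-- The pair `(a, b)` codes the rational number `a / (b + 1)`. -/
noncomputable def ratReal (q : ℤ × ℕ) : ℝ := (q.1 : ℝ) / ((q.2 : ℝ) + 1)

/-- The rational points of `ℝᵐ`. -/
noncomputable def ratPoint (m : ℕ) (q : Fin m → ℤ × ℕ) : EuclideanSpace ℝ (Fin m) :=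
  WithLp.toLp 2 fun i => ratReal (q i)

/-! ### Dynamics -/

/-- Topological transitivity of `f`. -/
def IsTransitiveMap {X : Type*} [TopologicalSpace X] (f : X → X) : Prop :=
  ∀ U V : Set X, IsOpen U → IsOpen V → U.Nonempty → V.Nonempty →
    ∃ n : ℕ, (f^[n] '' U ∩ V).Nonempty

/-- The rotation set of `Φ : X → ℝᵐ`: all vectors `(∫ Φ₁ dμ, …, ∫ Φₘ dμ)`, where `μ` is an
`f`-invariant Borel probability measure. -/
noncomputable def rotationSet {X : Type*} [TopologicalSpace X] [MeasurableSpace X] [BorelSpace X]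
    (f : X → X) {m : ℕ} (Φ : C(X, EuclideanSpace ℝ (Fin m))) : Set (EuclideanSpace ℝ (Fin m)) :=
  {w | ∃ μ : Measure X, IsProbabilityMeasure μ ∧ MeasurePreserving f μ μ ∧
    w = WithLp.toLp 2 fun i => ∫ x, Φ x i ∂μ}

/-! ### One-sided subshifts of finite type -/

/-- The shift space `X_A` of the transition matrix `A`, with the product topology. Sequences are
indexed from `0`. -/
def sftSpace {d : ℕ} (A : Matrix (Fin d) (Fin d) ℕ) : Set (ℕ → Fin d) :=
  {x | ∀ k, A (x k) (x (k + 1)) = 1}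

/-- The shift map on `X_A`. -/
def sftShift {d : ℕ} (A : Matrix (Fin d) (Fin d) ℕ) (x : sftSpace A) : sftSpace A :=
  ⟨fun k => x.1 (k + 1), fun k => x.2 (k + 1)⟩

/-- The distance `d_θ(x, y) = θ ^ min {k ≥ 1 : x_k ≠ y_k}` for sequences indexed from `1`, hence
the shift by one in the exponent. -/
noncomputable def sftDist {d : ℕ} (A : Matrix (Fin d) (Fin d) ℕ) (θ : ℝ) (x y : sftSpace A) : ℝ :=
  open Classical in if x = y then 0 else θ ^ (sInf {k : ℕ | x.1 k ≠ y.1 k} + 1)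

/-- An oracle for a sequence returns its letters. -/
def SftOracle {d : ℕ} (A : Matrix (Fin d) (Fin d) ℕ) (φ : ℕ → ℕ) (x : sftSpace A) : Prop :=
  ∀ k, φ k = (x.1 k : ℕ)

/-- An oracle for a pair of sequences returns the pairs of their letters. -/
def SftPairOracle {d : ℕ} (A : Matrix (Fin d) (Fin d) ℕ) (φ : ℕ → ℕ)
    (p : sftSpace A × sftSpace A) : Prop :=
  ∀ k, φ k = Nat.pair (p.1.1 k : ℕ) (p.2.1 k : ℕ)

/-! ### Oracle computations with partial oracles -/

namespace OracleCode

/-! A halting oracle computation reads finitely many letters, and extending the oracle does not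
change its result (`exists_mem_eval_of_directed`, `eval_mono`). Since the shift space is compact,
for each precision `δ` some word length `k` and step bound `s` suffice at all points. A search finds
such a pair, and `Φ` is replaced within `δ` by a function `g` of the first `k` letters, tabulated on
the finitely many admissible words.

It remains to approximate the rotation set by finitely many sums of `g`. In one direction,
transitivity closes up any orbit segment at bounded cost (`exists_periodic_shadow`), and periodic
averages are rotation vectors, so long Birkhoff averages lie near the rotation set. By convexity, so
do averages of several of them.

Conversely, let `y = ∫ Φ dμ`. By invariance the vectors `S_N Φ(x) - N y` have `μ`-mean zero, so each
linear functional is nonpositive on one of them. Choosing each vector against the sum of those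
already chosen keeps the norm of a sum of `Q` vectors of order `√Q` (`exists_norm_sum_sq_le`). With
`Q = R²` the average of `Q` Birkhoff averages is within `2M/R` of `y`, where `M` bounds `‖Φ‖`. Thus
the averages of `R²` Birkhoff averages of `g`, computed from words, form a net for the rotation set;
neither ergodic decomposition nor extreme points are needed. -/

theorem eval_mono {φ φ' : ℕ →. ℕ} (h : ∀ i v, v ∈ φ i → v ∈ φ' i) (c : OracleCode) :
    ∀ n v, v ∈ c.eval φ n → v ∈ c.eval φ' n := by
  induction c with
  | zero | succ | left | right => exact fun n v hv => hv
  | oracle => exact h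
  | pair f g hf hg =>
    intro n v hv
    simp only [eval, Seq.seq, Part.mem_bind_iff, Part.map_eq_map, Part.mem_map_iff] at hv ⊢
    obtain ⟨_, ⟨a, ha, rfl⟩, b, hb, rfl⟩ := hv
    exact ⟨_, ⟨a, hf _ _ ha, rfl⟩, b, hg _ _ hb, rfl⟩
  | comp f g hf hg =>
    intro n v hv
    obtain ⟨a, ha, hv⟩ := Part.mem_bind_iff.1 hv
    exact Part.mem_bind_iff.2 ⟨a, hg _ _ ha, hf _ _ hv⟩
  | prec f g hf hg =>
    intro n v hv
    simp only [eval] at hv ⊢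
    generalize n.unpair.2 = y at hv ⊢
    induction y generalizing v with
    | zero => exact hf _ _ hv
    | succ y ih =>
      simp only [Part.bind_eq_bind, Part.mem_bind_iff] at hv ⊢
      obtain ⟨i, hi, hv⟩ := hv
      exact ⟨i, ih _ hi, hg _ _ hv⟩
  | rfind f hf =>
    intro n v hv
    have key {b m} (h : b ∈ (fun m => decide (m = 0)) <$> f.eval φ (Nat.pair n m)) :
        b ∈ (fun m => decide (m = 0)) <$> f.eval φ' (Nat.pair n m) := by
      obtain ⟨a, ha, hb⟩ := (Part.mem_map_iff _).1 h
      exact (Part.mem_map_iff _).2 ⟨a, hf _ _ ha, hb⟩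
    obtain ⟨ht, hm⟩ := Nat.mem_rfind.1 hv
    exact Nat.mem_rfind.2 ⟨key ht, fun h => key (hm h)⟩

/-- A halting oracle computation uses only a finite part of the oracle. -/
theorem exists_mem_eval_of_directed {φ : ℕ →. ℕ} {ψ : ℕ → ℕ →. ℕ}
    (hψ : ∀ K K', K ≤ K' → ∀ i v, v ∈ ψ K i → v ∈ ψ K' i)
    (hφ : ∀ i v, v ∈ φ i → ∃ K, v ∈ ψ K i) (c : OracleCode) :
    ∀ n v, v ∈ c.eval φ n → ∃ K, v ∈ c.eval (ψ K) n := by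
  have mono (c : OracleCode) {K K'} (h : K ≤ K') := eval_mono (hψ K K' h) c
  induction c with
  | zero | succ | left | right => exact fun n v hv => ⟨0, hv⟩
  | oracle => exact hφ
  | pair f g hf hg =>
    intro n v hv
    simp only [eval, Seq.seq, Part.mem_bind_iff, Part.map_eq_map, Part.mem_map_iff] at hv ⊢
    obtain ⟨_, ⟨a, ha, rfl⟩, b, hb, rfl⟩ := hv
    obtain ⟨K, hK⟩ := hf _ _ ha
    obtain ⟨K', hK'⟩ := hg _ _ hb
    exact ⟨max K K', _, ⟨a, mono f (le_max_left _ _) _ _ hK, rfl⟩,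
      b, mono g (le_max_right _ _) _ _ hK', rfl⟩
  | comp f g hf hg =>
    intro n v hv
    obtain ⟨a, ha, hv⟩ := Part.mem_bind_iff.1 hv
    obtain ⟨K, hK⟩ := hg _ _ ha
    obtain ⟨K', hK'⟩ := hf _ _ hv
    exact ⟨max K K', Part.mem_bind_iff.2
      ⟨a, mono g (le_max_left _ _) _ _ hK, mono f (le_max_right _ _) _ _ hK'⟩⟩
  | prec f g hf hg =>
    intro n v hv
    -- Asking for all larger stages lets the stages of successive recursion steps be merged by a
    -- maximum.
    suffices ∃ K, ∀ K' ≥ K, v ∈ (prec f g).eval (ψ K') n from this.imp fun K hK => hK K le_rfl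
    simp only [eval] at hv ⊢
    generalize n.unpair.2 = y at hv ⊢
    induction y generalizing v with
    | zero => exact (hf _ _ hv).imp fun K hK K' hK' => mono f hK' _ _ hK
    | succ y ih =>
      simp only [Part.bind_eq_bind, Part.mem_bind_iff] at hv ⊢
      obtain ⟨i, hi, hv⟩ := hv
      obtain ⟨K, hK⟩ := ih _ hi
      obtain ⟨K₁, hK₁⟩ := hg _ _ hv
      exact ⟨max K K₁, fun K' hK' => ⟨i, hK _ (le_of_max_le_left hK'),
        mono g (le_of_max_le_right hK') _ _ hK₁⟩⟩
  | rfind f hf =>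
    intro n v hv
    obtain ⟨ht, hm⟩ := Nat.mem_rfind.1 hv
    obtain ⟨a, ha, ha'⟩ := (Part.mem_map_iff _).1 ht
    obtain ⟨K, hK⟩ := hf _ _ ha
    -- A search that stops at `v` has evaluated only the arguments `j < v`, so finitely many stages
    -- have to be merged.
    have : ∀ j, ∃ K, ∀ b, j < v → b ∈ f.eval φ (Nat.pair n j) →
        b ∈ f.eval (ψ K) (Nat.pair n j) := by
      intro j
      by_cases hj : j < v
      · obtain ⟨b, hb, -⟩ := (Part.mem_map_iff _).1 (hm hj)
        obtain ⟨K, hK⟩ := hf _ _ hb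
        exact ⟨K, fun b' _ hb' => Part.mem_unique hb' hb ▸ hK⟩
      · exact ⟨0, fun _ h => absurd h hj⟩
    choose k hk using this
    refine ⟨max K ((Finset.range v).sup k), Nat.mem_rfind.2 ⟨(Part.mem_map_iff _).2
      ⟨a, mono f (le_max_left _ _) _ _ hK, ha'⟩, fun {j} hj => ?_⟩⟩
    obtain ⟨b, hb, hb'⟩ := (Part.mem_map_iff _).1 (hm hj)
    exact (Part.mem_map_iff _).2 ⟨b, mono f ((Finset.le_sup (Finset.mem_range.2 hj)).trans (le_max_right _ _)) _ _
      (hk j b hj hb), hb'⟩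

/-- A program is partial recursive in its input and a parameter on which the oracle depends
partial recursively. -/
theorem partrec_eval {α : Type*} [Primcodable α] {φ : α → ℕ →. ℕ} (hφ : Partrec₂ φ)
    (c : OracleCode) : Partrec₂ fun a n => c.eval (φ a) n := by
  induction c with
  | zero => exact (Computable.const 0).partrec.to₂
  | succ => exact (Computable.succ.comp Computable.snd).partrec.to₂
  | left => exact (Computable.fst.comp (Computable.unpair.comp Computable.snd)).partrec.to₂
  | right => exact (Computable.snd.comp (Computable.unpair.comp Computable.snd)).partrec.to₂
  | oracle => exact hφ
  | pair f g hf hg =>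
    refine Partrec.of_eq (Partrec.bind hf (Partrec.map (hg.comp (Computable.fst.comp
      Computable.fst) (Computable.snd.comp Computable.fst)) ((Primrec₂.natPair.comp
        (Primrec.snd.comp Primrec.fst) Primrec.snd).to_comp.to₂)).to₂) ?_
    rintro ⟨a, n⟩
    simp [eval, Seq.seq, Part.bind_map]
  | comp f g hf hg =>
    exact (Partrec.bind hg (hf.comp (Computable.fst.comp Computable.fst) Computable.snd).to₂).to₂
  | prec f g hf hg =>
    exact (Partrec.nat_rec
      (f := fun p : α × ℕ => p.2.unpair.2) (g := fun p : α × ℕ => f.eval (φ p.1) p.2.unpair.1)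
      (h := fun (p : α × ℕ) (q : ℕ × ℕ) =>
        g.eval (φ p.1) (Nat.pair p.2.unpair.1 (Nat.pair q.1 q.2)))
      (Computable.snd.comp (Computable.unpair.comp Computable.snd))
      (hf.comp Computable.fst (Computable.fst.comp (Computable.unpair.comp Computable.snd)))
      (hg.comp (Computable.fst.comp Computable.fst)
        (Primrec₂.natPair.comp (Primrec.fst.comp (Primrec.unpair.comp
          (Primrec.snd.comp Primrec.fst))) (Primrec₂.natPair.comp
            (Primrec.fst.comp Primrec.snd) (Primrec.snd.comp Primrec.snd))).to_comp).to₂).to₂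
  | rfind f hf =>
    exact (Partrec.rfind (p := fun (p : α × ℕ) m =>
        (fun m => decide (m = 0)) <$> f.eval (φ p.1) (Nat.pair p.2 m))
      (Partrec.map (hf.comp (Computable.fst.comp Computable.fst)
        (Primrec₂.natPair.comp (Primrec.snd.comp Primrec.fst) Primrec.snd).to_comp)
        ((Primrec.eq.comp Primrec.snd (Primrec.const 0)).decide.to_comp).to₂).to₂).to₂

end OracleCode

/-! ### Primitive recursive rational arithmetic -/

/-- The numbering of `ℤ` sends `n` to `2n` and `-(n+1)` to `2n+1`; integer arithmetic is reduced to
natural arithmetic through parity and halving. -/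
theorem Primrec.int_ofNat : Primrec (fun n : ℕ => (n : ℤ)) :=
  Primrec.encode_iff.1 ((Primrec.nat_mul.comp (Primrec.const 2) Primrec.id).of_eq fun _ => rfl)

theorem Primrec.int_negSucc : Primrec Int.negSucc :=
  Primrec.encode_iff.1 ((Primrec.succ.comp
    (Primrec.nat_mul.comp (Primrec.const 2) Primrec.id)).of_eq fun _ => rfl)

theorem Primrec.int_toNat : Primrec Int.toNat := by
  have h : Primrec fun z : ℤ =>
      if Encodable.encode z % 2 = 0 then Encodable.encode z / 2 else 0 :=
    Primrec.ite (Primrec.eq.comp (Primrec.nat_mod.comp Primrec.encode (Primrec.const 2))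
      (Primrec.const 0)) (Primrec.nat_div.comp Primrec.encode (Primrec.const 2)) (Primrec.const 0)
  refine h.of_eq fun z => ?_
  cases z with
  | ofNat n =>
    have : Encodable.encode (n : ℤ) = 2 * n := rfl
    simp [this]
  | negSucc n =>
    have : Encodable.encode (Int.negSucc n) = 2 * n + 1 := rfl
    rw [this, if_neg (by omega)]
    rfl

theorem Primrec.int_toNat_neg : Primrec fun z : ℤ => (-z).toNat := by
  have h : Primrec fun z : ℤ =>
      if Encodable.encode z % 2 = 0 then 0 else Encodable.encode z / 2 + 1 :=
    Primrec.ite (Primrec.eq.comp (Primrec.nat_mod.comp Primrec.encode (Primrec.const 2))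
      (Primrec.const 0)) (Primrec.const 0)
      (Primrec.succ.comp (Primrec.nat_div.comp Primrec.encode (Primrec.const 2)))
  refine h.of_eq fun z => ?_
  cases z with
  | ofNat n =>
    have : Encodable.encode (n : ℤ) = 2 * n := rfl
    simp [this]
  | negSucc n =>
    have : Encodable.encode (Int.negSucc n) = 2 * n + 1 := rfl
    rw [this, if_neg (by omega), Int.neg_negSucc]
    simp only [Int.toNat_natCast]
    omega

theorem Primrec.int_subNatNat : Primrec₂ Int.subNatNat := by
  have h : Primrec fun p : ℕ × ℕ =>
      if p.2 ≤ p.1 then ((p.1 - p.2 : ℕ) : ℤ) else Int.negSucc (p.2 - p.1 - 1) :=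
    Primrec.ite (Primrec.nat_le.comp Primrec.snd Primrec.fst)
      (Primrec.int_ofNat.comp (Primrec.nat_sub.comp Primrec.fst Primrec.snd))
      (Primrec.int_negSucc.comp (Primrec.nat_sub.comp
        (Primrec.nat_sub.comp Primrec.snd Primrec.fst) (Primrec.const 1)))
  refine h.of_eq fun p => ?_
  split_ifs with hp
  · exact (Int.subNatNat_of_le hp).symm
  · rw [Int.subNatNat_eq_coe]
    omega

/-- Positive and negative parts are added separately and then subtracted. -/
theorem Primrec.int_add : Primrec₂ ((· + ·) : ℤ → ℤ → ℤ) := by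
  refine (Primrec.int_subNatNat.comp
    (Primrec.nat_add.comp (Primrec.int_toNat.comp Primrec.fst) (Primrec.int_toNat.comp Primrec.snd))
    (Primrec.nat_add.comp (Primrec.int_toNat_neg.comp Primrec.fst)
      (Primrec.int_toNat_neg.comp Primrec.snd)) : Primrec fun p : ℤ × ℤ => _).of_eq fun p => ?_
  rw [Int.subNatNat_eq_coe]
  dsimp only
  omega

theorem Primrec.int_mul_natCast : Primrec₂ (fun (z : ℤ) (n : ℕ) => z * n) := by
  refine (Primrec.int_subNatNat.comp
    (Primrec.nat_mul.comp (Primrec.int_toNat.comp Primrec.fst) Primrec.snd)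
    (Primrec.nat_mul.comp (Primrec.int_toNat_neg.comp Primrec.fst) Primrec.snd) :
      Primrec fun p : ℤ × ℕ => _).of_eq fun p => ?_
  rw [Int.subNatNat_eq_coe, Nat.cast_mul, Nat.cast_mul, ← sub_mul, Int.toNat_sub_toNat_neg]

/-- Addition of coded rational numbers. -/
def ratAdd (p q : ℤ × ℕ) : ℤ × ℕ :=
  (p.1 * (q.2 + 1 : ℕ) + q.1 * (p.2 + 1 : ℕ), (p.2 + 1) * (q.2 + 1) - 1)

/-- Division of a coded rational number by a natural number. -/
def ratDiv (p : ℤ × ℕ) (N : ℕ) : ℤ × ℕ := (p.1, (p.2 + 1) * N - 1)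

theorem primrec_ratAdd : Primrec₂ ratAdd := by
  have s1 := Primrec.succ.comp (Primrec.snd.comp (Primrec.fst (α := ℤ × ℕ) (β := ℤ × ℕ)))
  have s2 := Primrec.succ.comp (Primrec.snd.comp (Primrec.snd (α := ℤ × ℕ) (β := ℤ × ℕ)))
  exact Primrec.pair
    (Primrec.int_add.comp (Primrec.int_mul_natCast.comp (Primrec.fst.comp Primrec.fst) s2)
      (Primrec.int_mul_natCast.comp (Primrec.fst.comp Primrec.snd) s1))
    (Primrec.nat_sub.comp (Primrec.nat_mul.comp s1 s2) (Primrec.const 1))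

theorem primrec_ratDiv : Primrec₂ ratDiv :=
  Primrec.pair (Primrec.fst.comp Primrec.fst)
    (Primrec.nat_sub.comp (Primrec.nat_mul.comp
      (Primrec.succ.comp (Primrec.snd.comp Primrec.fst)) Primrec.snd) (Primrec.const 1))

theorem ratReal_ratAdd (p q : ℤ × ℕ) : ratReal (ratAdd p q) = ratReal p + ratReal q := by
  -- Codes store the denominator minus one; positivity makes the truncated subtraction exact.
  have h : 1 ≤ (p.2 + 1) * (q.2 + 1) := Nat.one_le_iff_ne_zero.2 (by positivity)
  simp only [ratReal, ratAdd]
  push_cast [h]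
  field_simp
  ring

theorem ratReal_ratDiv (p : ℤ × ℕ) {N : ℕ} (hN : 1 ≤ N) :
    ratReal (ratDiv p N) = ratReal p / N := by
  have h : 1 ≤ (p.2 + 1) * N := Nat.one_le_iff_ne_zero.2 (by positivity)
  simp only [ratReal, ratDiv]
  push_cast [h]
  field_simp
  ring

/-- Addition of coded rational points. -/
def pointAdd {m : ℕ} (p q : Fin m → ℤ × ℕ) : Fin m → ℤ × ℕ := fun i => ratAdd (p i) (q i)

/-- Division of a coded rational point by a natural number. -/
def pointDiv {m : ℕ} (p : Fin m → ℤ × ℕ) (N : ℕ) : Fin m → ℤ × ℕ := fun i => ratDiv (p i) N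

theorem primrec_pointAdd {m : ℕ} : Primrec₂ (pointAdd (m := m)) :=
  Primrec.fin_curry.2 (primrec_ratAdd.comp
    (Primrec.fin_app.comp (Primrec.fst.comp Primrec.fst) Primrec.snd)
    (Primrec.fin_app.comp (Primrec.snd.comp Primrec.fst) Primrec.snd))

theorem primrec_pointDiv {m : ℕ} : Primrec₂ (pointDiv (m := m)) :=
  Primrec.fin_curry.2 (primrec_ratDiv.comp
    (Primrec.fin_app.comp (Primrec.fst.comp Primrec.fst) Primrec.snd)
    (Primrec.snd.comp Primrec.fst))

theorem ratPoint_zero (m : ℕ) : ratPoint m (fun _ => (0, 0)) = 0 := by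
  ext i; simp [ratPoint, ratReal]

theorem ratPoint_pointAdd {m : ℕ} (p q : Fin m → ℤ × ℕ) :
    ratPoint m (pointAdd p q) = ratPoint m p + ratPoint m q := by
  ext i; simp [ratPoint, pointAdd, ratReal_ratAdd]

theorem ratPoint_pointDiv {m : ℕ} (p : Fin m → ℤ × ℕ) {N : ℕ} (hN : 1 ≤ N) :
    ratPoint m (pointDiv p N) = (N : ℝ)⁻¹ • ratPoint m p := by
  ext i; simp [ratPoint, pointDiv, ratReal_ratDiv _ hN, div_eq_inv_mul]

/-! ### Words and sums along words -/

section Words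

variable {α C : Type*} (E : Option α → List α)

/-- The words of length `k`, built by prepending letters; `E` lists the letters that may precede
a word with the given first letter. -/
def wordList (k : ℕ) : List (List α) :=
  Nat.rec [[]] (fun _ V => V.flatMap fun w => (E w.head?).map fun a => a :: w) k

/-- The words of length `k + N`, each together with the sum over its first `N` positions of the
values of the subwords of length `k`. -/
def wordSums (zero : C) (add : C → C → C) (val : List α → C) (k N : ℕ) : List (List α × C) :=
  Nat.rec ((wordList E k).map fun w => (w, zero))
    (fun _ V => V.flatMap fun p =>
      (E p.1.head?).map fun a => (a :: p.1, add (val ((a :: p.1).take k)) p.2)) N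

/-- The sums of `Q` members of a list. -/
def listSums (zero : C) (add : C → C → C) (S : List C) (Q : ℕ) : List C :=
  Nat.rec [zero] (fun _ T => T.flatMap fun t => S.map fun s => add t s) Q

variable [Primcodable α] [Finite α] [Primcodable C]

/-- `E` has finite domain, so it is a finite table and primitive recursive however it was defined.
No procedure for deciding which letters begin a point is required. -/
theorem primrec_wordList : Primrec (wordList E) := by
  have h : Primrec₂ fun (_ : ℕ) (V : List (List α)) =>
      V.flatMap fun w => (E w.head?).map fun a => a :: w := by
    refine Primrec.list_flatMap (g := fun (_ : ℕ × List (List α)) w =>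
      (E w.head?).map fun a => a :: w) Primrec.snd ?_
    exact Primrec.list_map (g := fun (p : (ℕ × List (List α)) × List α) a => a :: p.2)
      ((Primrec.dom_finite E).comp (Primrec.list_head?.comp Primrec.snd))
      (Primrec.list_cons.comp Primrec.snd (Primrec.snd.comp Primrec.fst))
  exact Primrec.nat_rec₁ _ h

theorem primrec_wordSums {β : Type*} [Primcodable β] {zero : C} {add : C → C → C}
    (hadd : Primrec₂ add) {val : β → List α → C} (hval : Primrec₂ val) {k N : β → ℕ}
    (hk : Primrec k) (hN : Primrec N) :
    Primrec fun b => wordSums E zero add (val b) (k b) (N b) := by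
  have h : Primrec₂ fun b (q : ℕ × List (List α × C)) => q.2.flatMap fun p =>
      (E p.1.head?).map fun a => (a :: p.1, add (val b ((a :: p.1).take (k b))) p.2) := by
    refine Primrec.list_flatMap (g := fun (x : β × ℕ × List (List α × C)) p =>
      (E p.1.head?).map fun a => (a :: p.1, add (val x.1 ((a :: p.1).take (k x.1))) p.2))
      (Primrec.snd.comp Primrec.snd) ?_
    refine Primrec.list_map (g := fun (y : (β × ℕ × List (List α × C)) × List α × C) a =>
      (a :: y.2.1, add (val y.1.1 ((a :: y.2.1).take (k y.1.1))) y.2.2))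
      ((Primrec.dom_finite E).comp (Primrec.list_head?.comp (Primrec.fst.comp Primrec.snd))) ?_
    have hp := Primrec.snd.comp
      (Primrec.fst (α := (β × ℕ × List (List α × C)) × List α × C) (β := α))
    have hb := Primrec.fst.comp (Primrec.fst.comp
      (Primrec.fst (α := (β × ℕ × List (List α × C)) × List α × C) (β := α)))
    have hc := Primrec.list_cons.comp
      (Primrec.snd (α := (β × ℕ × List (List α × C)) × List α × C) (β := α))
      (Primrec.fst.comp hp)
    exact Primrec.pair hc (hadd.comp (hval.comp hb (Primrec.list_take.comp (hk.comp hb) hc))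
      (Primrec.snd.comp hp))
  exact Primrec.nat_rec' hN (Primrec.list_map ((primrec_wordList E).comp hk)
    (Primrec.pair Primrec.snd (Primrec.const zero)).to₂) h

theorem primrec_listSums {β : Type*} [Primcodable β] {zero : C} {add : C → C → C}
    (hadd : Primrec₂ add) {S : β → List C} (hS : Primrec S) {Q : β → ℕ} (hQ : Primrec Q) :
    Primrec fun b => listSums zero add (S b) (Q b) := by
  refine Primrec.nat_rec' (f := Q) (g := fun _ => [zero])
    (h := fun b (q : ℕ × List C) => q.2.flatMap fun t => (S b).map fun s => add t s)
    hQ (Primrec.const _) ?_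
  exact (Primrec.list_flatMap (Primrec.snd.comp Primrec.snd) (Primrec.list_map
    (hS.comp (Primrec.fst.comp Primrec.fst))
    (hadd.comp (Primrec.snd.comp Primrec.fst) Primrec.snd).to₂).to₂).to₂

end Words

/-! ### Evaluation of oracle programs on words -/

/-- The partial oracle given by a word. -/
def wordOracle {d : ℕ} (w : List (Fin d)) : ℕ →. ℕ := fun i => (w[i]?.map Fin.val : Option ℕ)

theorem partrec_wordOracle {d : ℕ} : Partrec₂ (wordOracle (d := d)) :=
  (Computable.ofOption (Primrec.option_map Primrec.list_getElem?
    (Primrec.fin_val.comp Primrec.snd).to₂).to_comp).to₂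

/-- An ordinary code has the step-bounded evaluation `evaln`, which makes halting on a word within
`s` steps decidable. -/
theorem exists_code_wordOracle (d : ℕ) (c : OracleCode) : ∃ e : Nat.Partrec.Code,
    ∀ (w : List (Fin d)) n, e.eval (Nat.pair (Encodable.encode w) n) = c.eval (wordOracle w) n := by
  obtain ⟨e, he⟩ := Nat.Partrec.Code.exists_code.1 
    (c.partrec_eval (partrec_wordOracle (d := d)))
  refine ⟨e, fun w n => ?_⟩
  rw [he]
  have : Encodable.decode (α := List (Fin d) × ℕ) (Nat.pair (Encodable.encode w) n) = some (w, n) :=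
    Encodable.encodek (w, n)
  simp [this, Part.map_id']

/-- The value returned on input `n` within `s` steps for the word `w`. -/
def wordValue {d : ℕ} (C : Type*) [Primcodable C] (e : Nat.Partrec.Code) (n s : ℕ)
    (w : List (Fin d)) : Option C :=
  (Nat.Partrec.Code.evaln s e (Nat.pair (Encodable.encode w) n)).bind Encodable.decode

theorem primrec_wordValue {d : ℕ} (C : Type*) [Primcodable C] (e : Nat.Partrec.Code) :
    Primrec₂ fun (p : ℕ × ℕ) (w : List (Fin d)) => wordValue C e p.1 p.2 w := by
  refine Primrec.option_bind (Nat.Partrec.Code.primrec_evaln.comp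
    (Primrec.pair (Primrec.pair (Primrec.snd.comp Primrec.fst) (Primrec.const e))
      (Primrec₂.natPair.comp (Primrec.encode.comp Primrec.snd) (Primrec.fst.comp Primrec.fst))))
    (Primrec.decode.comp Primrec.snd).to₂

/-- This allows one step bound to serve finitely many words at once. -/
theorem wordValue_mono {d : ℕ} {C : Type*} [Primcodable C] {e : Nat.Partrec.Code} {n s s' : ℕ}
    (h : s ≤ s') {w : List (Fin d)} (hw : (wordValue C e n s w).isSome) :
    (wordValue C e n s' w).isSome := by
  obtain ⟨q, hq⟩ := Option.isSome_iff_exists.1 hw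
  obtain ⟨v, hv, hq⟩ := Option.bind_eq_some_iff.1 hq
  exact Option.isSome_iff_exists.2
    ⟨q, Option.bind_eq_some_iff.2 ⟨v, Nat.Partrec.Code.evaln_mono h hv, hq⟩⟩

/-! ### Rotation sets of continuous maps of compact metrizable spaces -/

section RotationSet

open Filter Topology

variable {X : Type*} [TopologicalSpace X] [CompactSpace X] [MeasurableSpace X] [BorelSpace X]
  {f : X → X} {m : ℕ} (Φ : C(X, EuclideanSpace ℝ (Fin m)))

theorem ContinuousMap.integrable_coord (μ : Measure X) [IsFiniteMeasure μ] (i : Fin m) :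
    Integrable (fun x => Φ x i) μ := by
  have hc : Continuous fun x => Φ x i := (EuclideanSpace.proj (𝕜 := ℝ) i).continuous.comp Φ.continuous
  exact (BoundedContinuousFunction.mkOfCompact ⟨_, hc⟩).integrable μ

theorem ContinuousMap.integrable_euclidean (μ : Measure X) [IsFiniteMeasure μ] :
    Integrable Φ μ := by
  have := (PiLp.continuousLinearEquiv 2 ℝ (fun _ : Fin m => ℝ)).symm.toContinuousLinearMap.integrable_comp
    (Integrable.of_eval fun i => Φ.integrable_coord μ i)
  exact this

theorem toLp_integral_eq (μ : Measure X) [IsFiniteMeasure μ] :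
    WithLp.toLp 2 (fun i => ∫ x, Φ x i ∂μ) = ∫ x, Φ x ∂μ := by
  ext i
  exact (EuclideanSpace.proj (𝕜 := ℝ) i).integral_comp_comm (Φ.integrable_euclidean μ)

/-- Replacing coordinate integrals by one vector-valued integral makes linearity and inner products
available. -/
theorem mem_rotationSet {w : EuclideanSpace ℝ (Fin m)} :
    w ∈ rotationSet f Φ ↔
      ∃ μ : Measure X, IsProbabilityMeasure μ ∧ MeasurePreserving f μ μ ∧ w = ∫ x, Φ x ∂μ :=
  exists_congr fun μ => and_congr_right fun _ => by rw [toLp_integral_eq]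

theorem convex_rotationSet (f : X → X) : Convex ℝ (rotationSet f Φ) := by
  intro v hv w hw a b ha hb hab
  obtain ⟨μ, hμ, hfμ, rfl⟩ := (mem_rotationSet Φ).1 hv
  obtain ⟨ν, hν, hfν, rfl⟩ := (mem_rotationSet Φ).1 hw
  refine (mem_rotationSet Φ).2 ⟨ENNReal.ofReal a • μ + ENNReal.ofReal b • ν, ⟨?_⟩,
    ⟨hfμ.measurable, ?_⟩, ?_⟩
  · simp [← ENNReal.ofReal_add ha hb, hab]
  · rw [Measure.map_add _ _ hfμ.measurable, Measure.map_smul, Measure.map_smul, hfμ.map_eq,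
      hfν.map_eq]
  · rw [integral_add_measure ((Φ.integrable_euclidean μ).smul_measure ENNReal.ofReal_ne_top)
      ((Φ.integrable_euclidean ν).smul_measure ENNReal.ofReal_ne_top), integral_smul_measure,
      integral_smul_measure, ENNReal.toReal_ofReal ha, ENNReal.toReal_ofReal hb]

/-- Invariant measures are weakly closed in the compact space of probability measures, and
integration of `Φ` is weakly continuous. -/
theorem isCompact_rotationSet [TopologicalSpace.MetrizableSpace X] (hf : Continuous f) :
    IsCompact (rotationSet f Φ) := by
  have hS : IsClosed {μ : ProbabilityMeasure X | μ.map hf.measurable.aemeasurable = μ} :=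
    isClosed_eq (ProbabilityMeasure.continuous_map hf) continuous_id
  have hI : Continuous fun μ : ProbabilityMeasure X =>
      (WithLp.toLp 2 fun i => ∫ x, Φ x i ∂(μ : Measure X) : EuclideanSpace ℝ (Fin m)) :=
    (PiLp.continuous_toLp 2 _).comp (continuous_pi fun i =>
      ProbabilityMeasure.continuous_integral_continuousMap
        (⟨fun x => Φ x i, (EuclideanSpace.proj (𝕜 := ℝ) i).continuous.comp Φ.continuous⟩ : C(X, ℝ)))
  convert! hS.isCompact.image hI
  ext w
  constructor
  · rintro ⟨μ, hμ, hfμ, rfl⟩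
    exact ⟨⟨μ, hμ⟩, Subtype.ext hfμ.map_eq, rfl⟩
  · rintro ⟨μ, hμ, rfl⟩
    exact ⟨μ, inferInstance, ⟨hf.measurable, congrArg Subtype.val hμ⟩, rfl⟩

/-- Birkhoff averages along periodic orbits belong to the rotation set. -/
theorem birkhoffAverage_mem_rotationSet (hf : Continuous f) {P : ℕ} (hP : 1 ≤ P) {p : X}
    (hp : f^[P] p = p) :
    (P : ℝ)⁻¹ • ∑ i ∈ Finset.range P, Φ (f^[i] p) ∈ rotationSet f Φ := by
  have hP0 : (P : ENNReal) ≠ 0 := by simpa using Nat.one_le_iff_ne_zero.1 hP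
  have hint (x : X) : ∫ y, Φ y ∂(Measure.dirac x) = Φ x :=
    integral_dirac' _ _ Φ.continuous.stronglyMeasurable
  refine (mem_rotationSet Φ).2 ⟨(P : ENNReal)⁻¹ • ∑ i ∈ Finset.range P, Measure.dirac (f^[i] p),
    ⟨?_⟩, ⟨hf.measurable, ?_⟩, ?_⟩
  · simp [ENNReal.inv_mul_cancel hP0 (ENNReal.natCast_ne_top P)]
  -- Pushing forward moves every atom one step along the orbit; `f^[P] p = p` then identifies the
  -- new last atom with the lost first one.
  · have h : ∀ n, Measure.map f (∑ i ∈ Finset.range n, Measure.dirac (f^[i] p)) =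
        ∑ i ∈ Finset.range n, Measure.dirac (f^[i + 1] p) := by
      intro n
      induction n with
      | zero => simp
      | succ n ih =>
        rw [Finset.sum_range_succ, Finset.sum_range_succ, Measure.map_add _ _ hf.measurable, ih,
          Measure.map_dirac' hf.measurable, Function.iterate_succ_apply']
    obtain ⟨P, rfl⟩ : ∃ n, P = n + 1 := ⟨P - 1, by omega⟩
    rw [Measure.map_smul, h, Finset.sum_range_succ, hp, Finset.sum_range_succ' _ P,
      Function.iterate_zero, id]
  · rw [integral_smul_measure, integral_finsetSum_measure fun i _ => Φ.integrable_euclidean _]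
    simp [hint]

/-- Every linear functional takes, on some Birkhoff average, at most its value at a given point of
the rotation set. -/
theorem exists_inner_birkhoffSum_le {y : EuclideanSpace ℝ (Fin m)} (hy : y ∈ rotationSet f Φ)
    (e : EuclideanSpace ℝ (Fin m)) (N : ℕ) :
    ∃ x, inner ℝ e ((∑ i ∈ Finset.range N, Φ (f^[i] x)) - (N : ℝ) • y) ≤ 0 := by
  obtain ⟨μ, hμ, hfμ, rfl⟩ := (mem_rotationSet Φ).1 hy
  have hm (i : ℕ) : MeasurePreserving f^[i] μ μ := hfμ.iterate i
  have hi (i : ℕ) : Integrable (fun x => Φ (f^[i] x)) μ :=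
    (hm i).integrable_comp_of_integrable (Φ.integrable_euclidean μ)
  have hs : Integrable (fun x => ∑ i ∈ Finset.range N, Φ (f^[i] x)) μ :=
    integrable_finsetSum _ fun i _ => hi i
  have hsc : Integrable (fun x => (∑ i ∈ Finset.range N, Φ (f^[i] x)) - (N : ℝ) • ∫ x, Φ x ∂μ) μ :=
    hs.sub (integrable_const _)
  -- Some point has value at most the mean, and the mean is zero by invariance.
  obtain ⟨x, hx⟩ := exists_le_integral (hsc.const_inner (𝕜 := ℝ) e)
  refine ⟨x, hx.trans_eq ?_⟩
  have hc (i : ℕ) : ∫ x, Φ (f^[i] x) ∂μ = ∫ x, Φ x ∂μ := by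
    have := integral_map (μ := μ) (hm i).measurable.aemeasurable
      (f := Φ) (Φ.continuous.aestronglyMeasurable)
    rw [← this, (hm i).map_eq]
  rw [integral_inner hsc, integral_sub hs (integrable_const _), integral_finsetSum _ fun i _ => hi i]
  simp [hc, ← Nat.cast_smul_eq_nsmul ℝ]

end RotationSet

/-- Greedy choice: if every linear functional is nonpositive somewhere on a family of vectors of
norm at most `D`, then sums of `Q` members of the family can be kept of norm `D √Q`. -/
theorem exists_norm_sum_sq_le {ι E : Type*} [NormedAddCommGroup E] [InnerProductSpace ℝ E]
    {v : ι → E} {D : ℝ} (hD : ∀ i, ‖v i‖ ≤ D) (hv : ∀ e, ∃ i, inner ℝ e (v i) ≤ 0) (Q : ℕ) :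
    ∃ s : ℕ → ι, ‖∑ j ∈ Finset.range Q, v (s j)‖ ^ 2 ≤ Q * D ^ 2 := by
  choose c hc using hv
  -- `e` is the running sum. The next vector has nonpositive inner product with it, so the squared
  -- norm grows by at most `D ^ 2`.
  let e : ℕ → E := fun j => Nat.rec 0 (fun _ e => e + v (c e)) j
  have he : ∀ n, ∑ j ∈ Finset.range n, v (c (e j)) = e n := by
    intro n
    induction n with
    | zero => rfl
    | succ n ih => rw [Finset.sum_range_succ, ih]
  refine ⟨fun j => c (e j), ?_⟩
  rw [he]
  induction Q with
  | zero => simp [e]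
  | succ n ih =>
    have h1 := hc (e n)
    have h2 : ‖v (c (e n))‖ ^ 2 ≤ D ^ 2 := pow_le_pow_left₀ (norm_nonneg _) (hD _) 2
    have h3 := norm_add_sq_real (e n) (v (c (e n)))
    change ‖e n + v (c (e n))‖ ^ 2 ≤ _
    rw [h3]
    push_cast
    linarith

/-! ### Subshifts of finite type -/

section Sft

variable {d : ℕ} {A : Matrix (Fin d) (Fin d) ℕ}

theorem isClosed_sftSpace (A : Matrix (Fin d) (Fin d) ℕ) : IsClosed (sftSpace A) := by
  have : sftSpace A = ⋂ k, {x : ℕ → Fin d | A (x k) (x (k + 1)) = 1} := by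
    ext x; simp [sftSpace]
  rw [this]
  refine isClosed_iInter fun k => ?_
  have hc : Continuous fun x : ℕ → Fin d => A (x k) (x (k + 1)) :=
    (continuous_of_discreteTopology (f := fun p : Fin d × Fin d => A p.1 p.2)).comp'
      ((continuous_apply (A := fun _ : ℕ => Fin d) k).prodMk (continuous_apply (k + 1)))
  exact (isClosed_discrete {1}).preimage hc

instance : CompactSpace (sftSpace A) := isCompact_iff_compactSpace.1 (isClosed_sftSpace A).isCompact

theorem continuous_sftShift : Continuous (sftShift A) :=
  Continuous.subtype_mk (continuous_pi fun k =>
    (continuous_apply (A := fun _ : ℕ => Fin d) (k + 1)).comp' continuous_subtype_val) _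

theorem isOpen_setOf_letter (k : ℕ) (a : Fin d) : IsOpen {x : sftSpace A | x.1 k = a} :=
  (isOpen_discrete {a}).preimage
    ((continuous_apply (A := fun _ : ℕ => Fin d) k).comp' continuous_subtype_val)

theorem sftShift_iterate_apply (x : sftSpace A) (n k : ℕ) :
    ((sftShift A)^[n] x).1 k = x.1 (k + n) := by
  induction n generalizing x with
  | zero => rfl
  | succ n ih => rw [Function.iterate_succ_apply, ih]; exact congrArg x.1 (by omega)

/-- Letters are connected within a bounded number of steps. -/
theorem exists_connecting_bound (htrans : IsTransitiveMap (sftShift A)) :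
    ∃ L : ℕ, ∀ x y : sftSpace A, ∃ n ≤ L, ∃ z : sftSpace A, z.1 0 = x.1 0 ∧ z.1 n = y.1 0 := by
  have h : ∀ q : Fin d × Fin d, ∃ n, ∀ x y : sftSpace A, x.1 0 = q.1 → y.1 0 = q.2 →
      ∃ z : sftSpace A, z.1 0 = x.1 0 ∧ z.1 n = y.1 0 := by
    rintro ⟨a, b⟩
    by_cases hxy : ∃ x y : sftSpace A, x.1 0 = a ∧ y.1 0 = b
    · obtain ⟨x, y, hx, hy⟩ := hxy
      obtain ⟨n, _, ⟨z, hz, rfl⟩, hzn⟩ := htrans _ _ (isOpen_setOf_letter 0 a)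
        (isOpen_setOf_letter 0 b) ⟨x, hx⟩ ⟨y, hy⟩
      refine ⟨n, fun x y hx hy => ⟨z, hz.trans hx.symm, ?_⟩⟩
      have : ((sftShift A)^[n] z).1 0 = b := hzn
      rw [sftShift_iterate_apply, zero_add] at this
      exact this.trans hy.symm
    · exact ⟨0, fun x y hx hy => absurd ⟨x, y, hx, hy⟩ hxy⟩
  choose n hn using h
  exact ⟨Finset.univ.sup n, fun x y =>
    ⟨n (x.1 0, y.1 0), Finset.le_sup (Finset.mem_univ _), hn _ x y rfl rfl⟩⟩

/-- An initial segment of a point is shadowed by a periodic point whose period exceeds the length of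
the segment by a bounded amount. -/
theorem exists_periodic_shadow (htrans : IsTransitiveMap (sftShift A)) :
    ∃ L : ℕ, ∀ (x : sftSpace A) (N : ℕ), 1 ≤ N → ∃ (p : sftSpace A) (P : ℕ),
      N ≤ P ∧ P ≤ N + L ∧ (sftShift A)^[P] p = p ∧ ∀ i < N, p.1 i = x.1 i := by
  obtain ⟨L, hL⟩ := exists_connecting_bound htrans
  refine ⟨L, fun x N hN => ?_⟩
  -- `y` leads from the letter `x_N` back to `x_0` in `n ≤ L` steps. Following `x` for `N` letters
  -- and then `y` gives a closed path of length `N + n`.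
  obtain ⟨n, hn, y, hy0, hyn⟩ := hL ((sftShift A)^[N] x) x
  rw [sftShift_iterate_apply, zero_add] at hy0
  let z : ℕ → Fin d := fun i => if i < N then x.1 i else y.1 (i - N)
  have hz : ∀ i, A (z i) (z (i + 1)) = 1 := by
    intro i
    rcases lt_trichotomy (i + 1) N with h | h | h
    · simp only [z, if_pos h, if_pos (show i < N by omega)]
      exact x.2 i
    · subst h
      simp only [z, if_pos (Nat.lt_succ_self i), lt_irrefl, if_false, Nat.sub_self, hy0]
      exact x.2 i
    · simp only [z, if_neg (show ¬ i < N by omega), if_neg (show ¬ i + 1 < N by omega)]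
      rw [show i + 1 - N = (i - N) + 1 by omega]
      exact y.2 _
  have hzP : z (N + n) = z 0 := by
    simp only [z, if_neg (show ¬ N + n < N by omega), if_pos (show 0 < N by omega)]
    rw [Nat.add_sub_cancel_left, hyn]
  refine ⟨⟨fun i => z (i % (N + n)), fun i => ?_⟩, N + n, by omega, by omega, ?_, fun i hi => ?_⟩
  · have hlt := Nat.mod_lt i (show 0 < N + n by omega)
    rcases eq_or_lt_of_le (Nat.succ_le_of_lt hlt) with h | h
    · have h1 : (i + 1) % (N + n) = 0 := by
        rw [← Nat.mod_add_mod, ← Nat.succ_eq_add_one, h, Nat.mod_self]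
      have h2 := hz (i % (N + n))
      rw [← Nat.succ_eq_add_one, h, hzP] at h2
      simpa only [h1] using h2
    · have h1 : (i + 1) % (N + n) = i % (N + n) + 1 := by
        rw [← Nat.mod_add_mod, Nat.mod_eq_of_lt h]
      simpa only [h1] using hz (i % (N + n))
  · ext k
    rw [sftShift_iterate_apply]
    simp
  · simp only [z, Nat.mod_eq_of_lt (show i < N + n by omega), if_pos hi]

/-! ### The words of a subshift of finite type -/

/-- The initial word of length `k`. -/
def initialWord (x : ℕ → Fin d) (k : ℕ) : List (Fin d) := (List.range k).map x

theorem initialWord_succ (x : ℕ → Fin d) (k : ℕ) :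
    initialWord x (k + 1) = x 0 :: initialWord (fun i => x (i + 1)) k := by
  simp [initialWord, List.range_succ_eq_map, Function.comp_def]

theorem initialWord_take (x : ℕ → Fin d) (k j : ℕ) :
    (initialWord x (k + j)).take k = initialWord x k := by
  simp [initialWord, ← List.map_take, List.take_range]

theorem initialWord_congr {x y : ℕ → Fin d} {k : ℕ} (h : ∀ i < k, x i = y i) :
    initialWord x k = initialWord y k :=
  List.map_congr_left fun i hi => h i (List.mem_range.1 hi)

theorem getElem?_initialWord (x : ℕ → Fin d) (k i : ℕ) :
    (initialWord x k)[i]? = if i < k then some (x i) else none := by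
  split_ifs with h
  · simp [initialWord, h]
  · simp [initialWord, Nat.le_of_not_lt h]

open Classical in
/-- The letters that may precede a word with the given first letter. -/
noncomputable def predecessors (A : Matrix (Fin d) (Fin d) ℕ) : Option (Fin d) → List (Fin d)
  | none => (List.finRange d).filter fun a => ∃ x : sftSpace A, x.1 0 = a
  | some b => (List.finRange d).filter fun a => A a b = 1

theorem mem_predecessors (x : sftSpace A) (k : ℕ) :
    x.1 0 ∈ predecessors A (initialWord (sftShift A x).1 k).head? := by
  cases k with
  | zero => simp [initialWord, predecessors]
  | succ k => simpa [initialWord_succ, predecessors] using! x.2 0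

theorem exists_initialWord_cons {a : Fin d} (x : sftSpace A) {k : ℕ}
    (ha : a ∈ predecessors A (initialWord x.1 k).head?) :
    ∃ x' : sftSpace A, initialWord x'.1 (k + 1) = a :: initialWord x.1 k := by
  cases k with
  | zero =>
    obtain ⟨x', hx', rfl⟩ : ∃ x' ∈ sftSpace A, x' 0 = a := by
      simpa [initialWord, predecessors] using ha
    exact ⟨⟨x', hx'⟩, by simp [initialWord]⟩
  | succ k =>
    have h : A a (x.1 0) = 1 := by simpa [initialWord_succ, predecessors] using ha
    refine ⟨⟨fun i => Nat.casesOn i a x.1, fun i => ?_⟩, initialWord_succ _ _⟩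
    cases i with
    | zero => exact h
    | succ i => exact x.2 i

/-- Growing words to the left is what makes this exact: a permitted letter in front of a point gives
a point, whereas appending letters could lead to a dead end. -/
theorem mem_wordList [hX : Nonempty (sftSpace A)] {k : ℕ} {w : List (Fin d)} :
    w ∈ wordList (predecessors A) k ↔ ∃ x : sftSpace A, initialWord x.1 k = w := by
  induction k generalizing w with
  | zero => simp [wordList, initialWord, eq_comm]
  | succ k ih =>
    have : w ∈ wordList (predecessors A) (k + 1) ↔ ∃ v ∈ wordList (predecessors A) k,
        ∃ a ∈ predecessors A v.head?, a :: v = w := by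
      simp [wordList]
    rw [this]
    constructor
    · rintro ⟨v, hv, a, ha, rfl⟩
      obtain ⟨x, rfl⟩ := ih.1 hv
      exact exists_initialWord_cons x ha
    · rintro ⟨x, rfl⟩
      exact ⟨_, ih.2 ⟨sftShift A x, rfl⟩, _, mem_predecessors x k, (initialWord_succ _ _).symm⟩

section Sums

variable {C F : Type*} [AddCommGroup F] {pt : C → F} {zero : C} {add : C → C → C}

theorem mem_wordSums_succ {val : List (Fin d) → C} {k N : ℕ} {p : List (Fin d) × C} :
    p ∈ wordSums (predecessors A) zero add val k (N + 1) ↔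
      ∃ q ∈ wordSums (predecessors A) zero add val k N, ∃ a ∈ predecessors A q.1.head?,
        (a :: q.1, add (val ((a :: q.1).take k)) q.2) = p := by
  simp [wordSums]

theorem exists_initialWord_of_mem_wordSums [Nonempty (sftSpace A)] {val : List (Fin d) → C}
    {k N : ℕ} {p : List (Fin d) × C}
    (hp : p ∈ wordSums (predecessors A) zero add val k N) :
    ∃ x : sftSpace A, initialWord x.1 (k + N) = p.1 := by
  induction N generalizing p with
  | zero =>
    obtain ⟨w, hw, rfl⟩ := List.mem_map.1 hp
    exact mem_wordList.1 hw
  | succ N ih =>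
    obtain ⟨q, hq, a, ha, rfl⟩ := mem_wordSums_succ.1 hp
    obtain ⟨x, hx⟩ := ih hq
    rw [← hx] at ha ⊢
    exact exists_initialWord_cons x ha

/-- The windows of length `k` starting at the first `N` positions fit in a word of length `k + N`,
so the sum depends only on that word. The prepended letter contributes the term `i = 0`. -/
theorem point_of_mem_wordSums (hzero : pt zero = 0) (hadd : ∀ a b, pt (add a b) = pt a + pt b)
    {val : List (Fin d) → C} {k N : ℕ} (x : sftSpace A) {s : C}
    (hs : (initialWord x.1 (k + N), s) ∈ wordSums (predecessors A) zero add val k N) :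
    pt s = ∑ i ∈ Finset.range N, pt (val (initialWord ((sftShift A)^[i] x).1 k)) := by
  induction N generalizing x s with
  | zero =>
    obtain ⟨w, hw, h⟩ := List.mem_map.1 hs
    have : zero = s := congrArg Prod.snd h
    rw [← this, hzero, Finset.range_zero, Finset.sum_empty]
  | succ N ih =>
    obtain ⟨⟨w, s'⟩, hq, a, ha, h⟩ := mem_wordSums_succ.1 hs
    obtain ⟨h1, rfl⟩ := Prod.ext_iff.1 h
    have h2 : a :: w = x.1 0 :: initialWord (sftShift A x).1 (k + N) :=
      h1.trans (initialWord_succ x.1 (k + N))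
    obtain rfl := (List.cons_eq_cons.1 h2).2
    dsimp only at h1 ⊢
    rw [hadd, ih (sftShift A x) hq, Finset.sum_range_succ', add_comm, h1, initialWord_take]
    rfl

theorem exists_mem_wordSums [Nonempty (sftSpace A)] (val : List (Fin d) → C) (k N : ℕ)
    (x : sftSpace A) :
    ∃ s, (initialWord x.1 (k + N), s) ∈ wordSums (predecessors A) zero add val k N := by
  induction N generalizing x with
  | zero => exact ⟨zero, List.mem_map.2 ⟨_, mem_wordList.2 ⟨x, rfl⟩, rfl⟩⟩
  | succ N ih =>
    obtain ⟨s, hs⟩ := ih (sftShift A x)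
    exact ⟨_, mem_wordSums_succ.2 ⟨_, hs, _, mem_predecessors x _,
      Prod.ext (initialWord_succ x.1 (k + N)).symm rfl⟩⟩

theorem point_of_mem_listSums (hzero : pt zero = 0) (hadd : ∀ a b, pt (add a b) = pt a + pt b)
    {S : List C} {Q : ℕ} {t : C} (ht : t ∈ listSums zero add S Q) :
    ∃ u : ℕ → C, (∀ j < Q, u j ∈ S) ∧ pt t = ∑ j ∈ Finset.range Q, pt (u j) := by
  induction Q generalizing t with
  | zero =>
    obtain rfl : t = zero := by simpa [listSums] using ht
    exact ⟨fun _ => t, by simp, by simpa using hzero⟩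
  | succ Q ih =>
    obtain ⟨t', ht', s, hs, rfl⟩ : ∃ t' ∈ listSums zero add S Q, ∃ s ∈ S, add t' s = t := by
      simpa [listSums] using ht
    obtain ⟨u, hu, hsum⟩ := ih ht'
    refine ⟨fun j => if j < Q then u j else s, fun j _ => ?_, ?_⟩
    · dsimp only
      split_ifs with h
      exacts [hu j h, hs]
    · rw [hadd, hsum, Finset.sum_range_succ]
      dsimp only
      rw [if_neg (lt_irrefl Q)]
      congr 1
      exact Finset.sum_congr rfl fun j hj => by rw [if_pos (Finset.mem_range.1 hj)]

theorem exists_mem_listSums (hzero : pt zero = 0) (hadd : ∀ a b, pt (add a b) = pt a + pt b)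
    {S : List C} {u : ℕ → C} (hu : ∀ j, u j ∈ S) (Q : ℕ) :
    ∃ t ∈ listSums zero add S Q, pt t = ∑ j ∈ Finset.range Q, pt (u j) := by
  induction Q with
  | zero => exact ⟨zero, by simp [listSums], by simpa using hzero⟩
  | succ Q ih =>
    obtain ⟨t, ht, hsum⟩ := ih
    refine ⟨add t (u Q), ?_, by rw [hadd, hsum, Finset.sum_range_succ]⟩
    have : ∃ t' ∈ listSums zero add S Q, ∃ s ∈ S, add t' s = add t (u Q) :=
      ⟨t, ht, _, hu Q, rfl⟩
    simpa [listSums] using! this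

end Sums

end Sft

/-! ### Reading a function off the words of a subshift -/

section WordValue

variable {d : ℕ} {A : Matrix (Fin d) (Fin d) ℕ} {C Y : Type*} [Primcodable C]
  [PseudoMetricSpace Y] {t : C → Y} {F : sftSpace A → Y} {c : OracleCode} {e : Nat.Partrec.Code}

theorem mem_wordOracle_initialWord {x : ℕ → Fin d} {k i v : ℕ} :
    v ∈ wordOracle (initialWord x k) i ↔ i < k ∧ v = x i := by
  rw [wordOracle, getElem?_initialWord]
  split_ifs with h <;> simp [h]

/-- A value found on an initial word is a correct approximation. -/
theorem dist_lt_of_wordValue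
    (hc : ∀ (φ : ℕ → ℕ) (x : sftSpace A), SftOracle A φ x → ∀ n : ℕ,
      ∃ q : C, Encodable.encode q ∈ c.eval (φ : ℕ →. ℕ) n ∧ dist (t q) (F x) < (1 / 2 : ℝ) ^ n)
    (he : ∀ (w : List (Fin d)) n,
      e.eval (Nat.pair (Encodable.encode w) n) = c.eval (wordOracle w) n)
    {n s k : ℕ} {x : sftSpace A} {q : C} (hq : wordValue C e n s (initialWord x.1 k) = some q) :
    dist (t q) (F x) < (1 / 2 : ℝ) ^ n := by
  obtain ⟨v, hv, hvq⟩ := Option.bind_eq_some_iff.1 hq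
  obtain ⟨q', hq', hd⟩ := hc (fun k => x.1 k) x (fun _ => rfl) n
  have h1 : v ∈ c.eval (wordOracle (initialWord x.1 k)) n := he _ _ ▸ Nat.Partrec.Code.evaln_sound hv
  have h2 := c.eval_mono (φ' := ((fun k => (x.1 k : ℕ) : ℕ → ℕ) : ℕ →. ℕ))
    (fun i v hv => by simpa using! (mem_wordOracle_initialWord.1 hv).2) _ _ h1
  rw [Part.mem_unique h2 hq', Encodable.encodek] at hvq
  exact Option.some_injective _ hvq ▸ hd

/-- By compactness, words of some fixed length suffice to find approximations everywhere. -/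
theorem exists_forall_wordValue_isSome [Nonempty (sftSpace A)]
    (hc : ∀ (φ : ℕ → ℕ) (x : sftSpace A), SftOracle A φ x → ∀ n : ℕ,
      ∃ q : C, Encodable.encode q ∈ c.eval (φ : ℕ →. ℕ) n ∧ dist (t q) (F x) < (1 / 2 : ℝ) ^ n)
    (he : ∀ (w : List (Fin d)) n,
      e.eval (Nat.pair (Encodable.encode w) n) = c.eval (wordOracle w) n) (n : ℕ) :
    ∃ k s, ∀ w ∈ wordList (predecessors A) k, (wordValue C e n s w).isSome := by
  -- `O k` consists of the points at which the first `k` letters already yield an answer; these sets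
  -- are open, increasing and cover the space.
  let O : ℕ → Set (sftSpace A) := fun k =>
    {x | ∃ q : C, Encodable.encode q ∈ c.eval (wordOracle (initialWord x.1 k)) n}
  have hmono (x : sftSpace A) {k k'} (h : k ≤ k') : ∀ i v,
      v ∈ wordOracle (initialWord x.1 k) i → v ∈ wordOracle (initialWord x.1 k') i :=
    fun i v hv => mem_wordOracle_initialWord.2
      ((mem_wordOracle_initialWord.1 hv).imp_left fun hi => hi.trans_le h)
  have hO : ∀ k, IsOpen (O k) := fun k => isOpen_iff_mem_nhds.2 fun x hx => by
    have hU : IsOpen (⋂ i ∈ Finset.range k, {y : sftSpace A | y.1 i = x.1 i}) :=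
      isOpen_biInter_finset fun i _ => isOpen_setOf_letter i (x.1 i)
    refine Filter.mem_of_superset (hU.mem_nhds (by simp)) fun y hy => ?_
    have : initialWord y.1 k = initialWord x.1 k :=
      initialWord_congr fun i hi => by simpa using! mem_iInter₂.1 hy i (Finset.mem_range.2 hi)
    change ∃ q : C, _
    rwa [this]
  have hcov : univ ⊆ ⋃ k, O k := fun x _ => by
    obtain ⟨q, hq, -⟩ := hc (fun k => x.1 k) x (fun _ => rfl) n
    obtain ⟨K, hK⟩ := c.exists_mem_eval_of_directed
      (ψ := fun k => wordOracle (initialWord x.1 k)) (fun _ _ h => hmono x h)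
      (fun i v hv => ⟨i + 1, mem_wordOracle_initialWord.2 ⟨Nat.lt_succ_self i, by simpa using! hv⟩⟩)
      _ _ hq
    exact mem_iUnion.2 ⟨K, q, hK⟩
  obtain ⟨k, hk⟩ := isCompact_univ.elim_directed_cover O hO hcov
    (Monotone.directed_le fun k k' h x => Exists.imp fun q hq => c.eval_mono (hmono x h) _ _ hq)
  have hs : ∀ w, ∃ s, w ∈ wordList (predecessors A) k → (wordValue C e n s w).isSome := by
    intro w
    by_cases hw : w ∈ wordList (predecessors A) k
    · obtain ⟨x, rfl⟩ := mem_wordList.1 hw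
      obtain ⟨q, hq⟩ := hk (mem_univ x)
      rw [← he] at hq
      obtain ⟨s, hs⟩ := Nat.Partrec.Code.evaln_complete.1 hq
      exact ⟨s, fun _ => Option.isSome_iff_exists.2
        ⟨q, Option.bind_eq_some_iff.2 ⟨_, hs, Encodable.encodek q⟩⟩⟩
    · exact ⟨0, fun h => absurd h hw⟩
  choose s hs using hs
  exact ⟨k, (wordList (predecessors A) k).toFinset.sup s, fun w hw =>
    wordValue_mono (Finset.le_sup (List.mem_toFinset.2 hw)) (hs w hw)⟩

/-- The search for a word length and a number of steps is effective. -/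
theorem exists_computable_search [Nonempty (sftSpace A)]
    (h : ∀ n : ℕ, ∃ k s, ∀ w ∈ wordList (predecessors A) k, (wordValue C e n s w).isSome) :
    ∃ r : ℕ → ℕ × ℕ, Computable r ∧ ∀ n,
      ∀ w ∈ wordList (predecessors A) (r n).1, (wordValue C e n (r n).2 w).isSome := by
  have hR : PrimrecRel fun (w : List (Fin d)) (p : ℕ × ℕ) =>
      (wordValue C e p.1 p.2 w).isSome := by
    refine Primrec.primrecPred ?_
    simpa using! Primrec.option_isSome.comp
      ((primrec_wordValue C e).comp Primrec.snd (Primrec.fst (α := List (Fin d))))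
  have hu : Primrec fun p : ℕ × ℕ => p.2.unpair := Primrec.unpair.comp Primrec.snd
  have hG := (hR.forall_mem_list.comp
    ((primrec_wordList (predecessors A)).comp (Primrec.fst.comp hu))
    (Primrec.pair Primrec.fst (Primrec.snd.comp hu))).decide
  -- The unbounded search runs over coded pairs `(k, s)`; each test is a finite check over the words
  -- of length `k`.
  have hf : Partrec fun n : ℕ => Nat.rfind fun j : ℕ => Part.some (decide
      (∀ w ∈ wordList (predecessors A) j.unpair.1, (wordValue C e n j.unpair.2 w).isSome)) :=
    Partrec.rfind (hG.to_comp.partrec.of_eq fun p => by simp)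
  have ht : ∀ n : ℕ, ∃ j : ℕ, ∀ w ∈ wordList (predecessors A) j.unpair.1,
      (wordValue C e n j.unpair.2 w).isSome := fun n => by
    obtain ⟨k, s, hks⟩ := h n
    exact ⟨Nat.pair k s, by simpa using hks⟩
  classical
  refine ⟨fun n => (Nat.find (ht n)).unpair, Computable.unpair.comp (hf.of_eq_tot fun n => ?_),
    fun n => Nat.find_spec (ht n)⟩
  refine Nat.mem_rfind.2 ⟨?_, fun {j} hj => ?_⟩
  · simpa using! Nat.find_spec (ht n)
  · simpa using! Nat.find_min (ht n) hj

end WordValue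

/-! ### Approximation of the rotation set of a subshift -/

section Approximation

variable {d m : ℕ} {A : Matrix (Fin d) (Fin d) ℕ} {Φ : C(sftSpace A, EuclideanSpace ℝ (Fin m))}
  {g : List (Fin d) → EuclideanSpace ℝ (Fin m)} {k L N Q : ℕ} {δ M : ℝ}

theorem norm_sum_sub_sum_le (hg : ∀ x : sftSpace A, ‖g (initialWord x.1 k) - Φ x‖ ≤ δ)
    (x : sftSpace A) (N : ℕ) :
    ‖∑ i ∈ Finset.range N, g (initialWord ((sftShift A)^[i] x).1 k) -
      ∑ i ∈ Finset.range N, Φ ((sftShift A)^[i] x)‖ ≤ N * δ := by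
  rw [← Finset.sum_sub_distrib]
  exact (norm_sum_le_of_le _ fun i _ => hg ((sftShift A)^[i] x)).trans (by simp)

/-- Long Birkhoff sums are close to multiples of rotation vectors. -/
theorem exists_mem_rotationSet_near
    (hL : ∀ (x : sftSpace A) (N : ℕ), 1 ≤ N → ∃ (p : sftSpace A) (P : ℕ),
      N ≤ P ∧ P ≤ N + L ∧ (sftShift A)^[P] p = p ∧ ∀ i < N, p.1 i = x.1 i)
    (hg : ∀ x : sftSpace A, ‖g (initialWord x.1 k) - Φ x‖ ≤ δ) (hM : ∀ x, ‖Φ x‖ ≤ M)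
    (hN : 1 ≤ N) (hNδ : 2 * (k + L) * M ≤ N * δ) (x : sftSpace A) :
    ∃ w ∈ rotationSet (sftShift A) Φ,
      ‖∑ i ∈ Finset.range N, g (initialWord ((sftShift A)^[i] x).1 k) - (N : ℝ) • w‖ ≤
        N * (2 * δ) := by
  -- Shadowing `N + k` letters makes all of the first `N` windows of length `k` agree.
  obtain ⟨p, P, h1, h2, hp, hpx⟩ := hL x (N + k) (by omega)
  have hM0 : 0 ≤ M := (norm_nonneg _).trans (hM x)
  have hw := birkhoffAverage_mem_rotationSet Φ continuous_sftShift (show 1 ≤ P by omega) hp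
  refine ⟨_, hw, ?_⟩
  set w := (P : ℝ)⁻¹ • ∑ i ∈ Finset.range P, Φ ((sftShift A)^[i] p) with hwdef
  have hP : (0 : ℝ) < P := by exact_mod_cast (show 0 < P by omega)
  have hPw : (P : ℝ) • w = ∑ i ∈ Finset.range P, Φ ((sftShift A)^[i] p) := by
    rw [hwdef, smul_inv_smul₀ hP.ne']
  have hnw : ‖w‖ ≤ M := by
    have : ‖(P : ℝ) • w‖ ≤ P * M := by
      rw [hPw]
      exact (norm_sum_le_of_le _ fun i _ => hM _).trans (by simp)
    rw [norm_smul, Real.norm_of_nonneg hP.le] at this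
    exact le_of_mul_le_mul_left this hP
  have hgx : ∑ i ∈ Finset.range N, g (initialWord ((sftShift A)^[i] x).1 k) =
      ∑ i ∈ Finset.range N, g (initialWord ((sftShift A)^[i] p).1 k) := by
    refine Finset.sum_congr rfl fun i hi => congrArg g (initialWord_congr fun j hj => ?_)
    have := Finset.mem_range.1 hi
    rw [sftShift_iterate_apply, sftShift_iterate_apply, hpx _ (by omega)]
  obtain ⟨r, rfl⟩ : ∃ r, P = N + r := ⟨P - N, by omega⟩
  have hr : (r : ℝ) ≤ k + L := by exact_mod_cast (show r ≤ k + L by omega)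
  rw [Finset.sum_range_add] at hPw
  have hrest : ‖∑ i ∈ Finset.range r, Φ ((sftShift A)^[N + i] p)‖ ≤ r * M :=
    (norm_sum_le_of_le _ fun i _ => hM _).trans (by simp)
  have hrw : ‖(r : ℝ) • w‖ ≤ r * M := by
    rw [norm_smul, Real.norm_of_nonneg (Nat.cast_nonneg r)]
    gcongr
  have hrM : (r : ℝ) * M ≤ (k + L) * M := by gcongr
  -- The errors are `N δ` for replacing `Φ` by `g`, and `r M` each for the remaining orbit terms and
  -- for `r • w`. As `r ≤ k + L`, the last two together are at most `N δ`.
  have hdec : ∑ i ∈ Finset.range N, g (initialWord ((sftShift A)^[i] p).1 k) - (N : ℝ) • w =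
      (∑ i ∈ Finset.range N, g (initialWord ((sftShift A)^[i] p).1 k) -
        ∑ i ∈ Finset.range N, Φ ((sftShift A)^[i] p)) -
      (∑ i ∈ Finset.range r, Φ ((sftShift A)^[N + i] p)) + (r : ℝ) • w := by
    rw [sub_sub, ← hPw, Nat.cast_add, add_smul]
    abel
  rw [hgx, hdec]
  have h3 := norm_add_le ((∑ i ∈ Finset.range N, g (initialWord ((sftShift A)^[i] p).1 k) -
        ∑ i ∈ Finset.range N, Φ ((sftShift A)^[i] p)) -
      (∑ i ∈ Finset.range r, Φ ((sftShift A)^[N + i] p))) ((r : ℝ) • w)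
  have h4 := norm_sub_le (∑ i ∈ Finset.range N, g (initialWord ((sftShift A)^[i] p).1 k) -
        ∑ i ∈ Finset.range N, Φ ((sftShift A)^[i] p))
      (∑ i ∈ Finset.range r, Φ ((sftShift A)^[N + i] p))
  have h5 := norm_sum_sub_sum_le hg p N
  linarith

/-- Averages of `Q` vectors near the rotation set are near the rotation set. -/
theorem exists_mem_rotationSet_average_near (hN : 1 ≤ N) (hQ : 1 ≤ Q)
    {v : ℕ → EuclideanSpace ℝ (Fin m)} {η : ℝ}
    (hv : ∀ j < Q, ∃ w ∈ rotationSet (sftShift A) Φ, ‖v j - (N : ℝ) • w‖ ≤ N * η) :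
    ∃ w ∈ rotationSet (sftShift A) Φ,
      dist (((Q * N : ℕ) : ℝ)⁻¹ • ∑ j ∈ Finset.range Q, v j) w ≤ η := by
  have hex : ∀ j, ∃ w, j < Q → w ∈ rotationSet (sftShift A) Φ ∧ ‖v j - (N : ℝ) • w‖ ≤ N * η :=
    fun j => by
      by_cases hj : j < Q
      · obtain ⟨w, hw⟩ := hv j hj
        exact ⟨w, fun _ => hw⟩
      · exact ⟨0, fun h => absurd h hj⟩
  choose w hw using hex
  have hQ0 : (0 : ℝ) < Q := by exact_mod_cast hQ
  have hN0 : (0 : ℝ) < N := by exact_mod_cast hN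
  refine ⟨∑ j ∈ Finset.range Q, (Q : ℝ)⁻¹ • w j,
    (convex_rotationSet Φ (sftShift A)).sum_mem (fun _ _ => by positivity)
      (by simp [mul_inv_cancel₀ hQ0.ne']) fun j hj => (hw j (Finset.mem_range.1 hj)).1, ?_⟩
  have hdec : ((Q * N : ℕ) : ℝ)⁻¹ • ∑ j ∈ Finset.range Q, v j -
      ∑ j ∈ Finset.range Q, (Q : ℝ)⁻¹ • w j =
      ((Q * N : ℕ) : ℝ)⁻¹ • ∑ j ∈ Finset.range Q, (v j - (N : ℝ) • w j) := by
    rw [Finset.sum_sub_distrib, smul_sub, ← Finset.smul_sum, ← Finset.smul_sum, smul_smul]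
    congr 3
    push_cast
    field_simp
  rw [dist_eq_norm, hdec, norm_smul, norm_inv, Real.norm_natCast, inv_mul_le_iff₀
    (by push_cast; positivity)]
  refine (norm_sum_le_of_le _ fun j hj => (hw j (Finset.mem_range.1 hj)).2).trans (le_of_eq ?_)
  simp [mul_assoc]

/-- Rotation vectors are close to averages of `R²` Birkhoff averages. -/
theorem exists_average_near_of_mem_rotationSet
    (hg : ∀ x : sftSpace A, ‖g (initialWord x.1 k) - Φ x‖ ≤ δ) (hM : ∀ x, ‖Φ x‖ ≤ M)
    (hN : 1 ≤ N) {R : ℕ} (hR : 1 ≤ R) (hRδ : 2 * M ≤ R * δ)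
    {y : EuclideanSpace ℝ (Fin m)} (hy : y ∈ rotationSet (sftShift A) Φ) :
    ∃ x : ℕ → sftSpace A, dist y ((((R * R * N : ℕ) : ℝ)⁻¹) • ∑ j ∈ Finset.range (R * R),
      ∑ i ∈ Finset.range N, g (initialWord ((sftShift A)^[i] (x j)).1 k)) ≤ 2 * δ := by
  have hR0 : (0 : ℝ) < R := by exact_mod_cast hR
  have hN0 : (0 : ℝ) < N := by exact_mod_cast hN
  have hyM : ‖y‖ ≤ M := by
    obtain ⟨μ, hμ, -, rfl⟩ := (mem_rotationSet Φ).1 hy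
    simpa using norm_integral_le_of_norm_le_const (μ := μ) (Filter.Eventually.of_forall hM)
  have hS (x : sftSpace A) :
      ‖(∑ i ∈ Finset.range N, Φ ((sftShift A)^[i] x)) - (N : ℝ) • y‖ ≤ N * (2 * M) := by
    have h1 : ‖∑ i ∈ Finset.range N, Φ ((sftShift A)^[i] x)‖ ≤ N * M :=
      (norm_sum_le_of_le _ fun i _ => hM _).trans (by simp)
    have h2 : ‖(N : ℝ) • y‖ ≤ N * M := by
      rw [norm_smul, Real.norm_natCast]
      gcongr
    linarith [norm_sub_le (∑ i ∈ Finset.range N, Φ ((sftShift A)^[i] x)) ((N : ℝ) • y)]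
  obtain ⟨x, hx⟩ := exists_norm_sum_sq_le hS
    (fun e => exists_inner_birkhoffSum_le Φ hy e N) (R * R)
  refine ⟨x, ?_⟩
  set b : ℕ → EuclideanSpace ℝ (Fin m) := fun j =>
    ∑ i ∈ Finset.range N, Φ ((sftShift A)^[i] (x j))
  set a : ℕ → EuclideanSpace ℝ (Fin m) := fun j =>
    ∑ i ∈ Finset.range N, g (initialWord ((sftShift A)^[i] (x j)).1 k)
  have hM0 : 0 ≤ M := (norm_nonneg _).trans hyM
  -- This is the greedy bound with `D = 2 M N` and `R²` vectors. Division by `R² N` leaves `2 M / R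
  -- ≤ δ`.
  have h1 : ‖∑ j ∈ Finset.range (R * R), (b j - (N : ℝ) • y)‖ ≤ R * (N * (2 * M)) := by
    refine le_of_sq_le_sq ?_ (by positivity)
    refine hx.trans_eq ?_
    push_cast
    ring
  have h2 : ‖∑ j ∈ Finset.range (R * R), (a j - b j)‖ ≤ R * R * (N * δ) :=
    (norm_sum_le_of_le _ fun j _ => norm_sum_sub_sum_le hg (x j) N).trans (by simp)
  have hdec : (((R * R * N : ℕ) : ℝ)⁻¹) • ∑ j ∈ Finset.range (R * R), a j - y =
      (((R * R * N : ℕ) : ℝ)⁻¹) • (∑ j ∈ Finset.range (R * R), (a j - b j) +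
        ∑ j ∈ Finset.range (R * R), (b j - (N : ℝ) • y)) := by
    rw [← Finset.sum_add_distrib]
    simp only [sub_add_sub_cancel]
    rw [Finset.sum_sub_distrib, smul_sub]
    congr 1
    rw [Finset.sum_const, Finset.card_range, ← Nat.cast_smul_eq_nsmul ℝ, smul_smul, smul_smul]
    push_cast
    rw [show ((R : ℝ) * R * N)⁻¹ * (R * R) * N = 1 by field_simp, one_smul]
  rw [dist_comm, dist_eq_norm, hdec, norm_smul, norm_inv, Real.norm_natCast, inv_mul_le_iff₀
    (by push_cast; positivity)]
  have h3 : (R : ℝ) * (N * (2 * M)) ≤ R * (N * (R * δ)) := by gcongr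
  push_cast
  linarith [norm_add_le (∑ j ∈ Finset.range (R * R), (a j - b j))
    (∑ j ∈ Finset.range (R * R), (b j - (N : ℝ) • y))]

end Approximation

theorem theoremA {d m : ℕ} (A : Matrix (Fin d) (Fin d) ℕ) (hA : ∀ i j, A i j = 0 ∨ A i j = 1)
    (htrans : IsTransitiveMap (sftShift A))
    (θ : ℝ) (hθ : θ ∈ Set.Ioo (0 : ℝ) 1)
    (hdist : IsComputableMap (SftPairOracle A) ratReal
      (fun p : sftSpace A × sftSpace A => sftDist A θ p.1 p.2))
    (Φ : C(sftSpace A, EuclideanSpace ℝ (Fin m)))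
    (hΦ : IsComputableMap (SftOracle A) (ratPoint m) Φ) :
    IsComputableCompact (ratPoint m) (rotationSet (sftShift A) Φ) := by
  refine ⟨isCompact_rotationSet Φ continuous_sftShift, ?_⟩
  -- An empty space carries no probability measure, and the empty list of balls is exact.
  rcases isEmpty_or_nonempty (sftSpace A) with hX | hX
  · have hrot : rotationSet (sftShift A) Φ = ∅ := by
      refine eq_empty_of_forall_notMem fun w hw => ?_
      obtain ⟨μ, hμ, -⟩ := hw
      exact hX.elim μ.nonempty_of_neZero.some
    refine ⟨fun _ => [], Computable.const _, fun n => ?_⟩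
    simp [hrot]
  obtain ⟨c, hc⟩ := hΦ
  obtain ⟨e, he⟩ := exists_code_wordOracle d c
  obtain ⟨r, hr, hrs⟩ := exists_computable_search (exists_forall_wordValue_isSome hc he)
  obtain ⟨L, hL⟩ := exists_periodic_shadow htrans
  -- `M` and `L` are fixed constants built into the algorithm, so only their existence matters. `1 ≤
  -- M` ensures that `R` is positive.
  obtain ⟨M, hM1, hM⟩ : ∃ M : ℕ, 1 ≤ M ∧ ∀ x, ‖Φ x‖ ≤ M := by
    obtain ⟨B, hB⟩ := isCompact_univ.exists_bound_of_continuousOn Φ.continuous.continuousOn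
    exact ⟨⌈B⌉₊ + 1, by omega, fun x => (hB x (mem_univ x)).trans
      ((Nat.le_ceil B).trans (by push_cast; linarith))⟩
  let zero : Fin m → ℤ × ℕ := fun _ => (0, 0)
  let val : ℕ × ℕ → List (Fin d) → (Fin m → ℤ × ℕ) := fun p w =>
    (wordValue (Fin m → ℤ × ℕ) e p.1 p.2 w).getD zero
  -- At precision `δ = 2⁻ⁿ` this gives `R δ = 2 M`, and the next line gives `N δ = 2 (k + L) M + δ`;
  -- its `+ 1` keeps `N` positive.
  let R : ℕ → ℕ := fun n => M * 2 ^ (n + 1)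
  let N : ℕ × ℕ → ℕ := fun p => (p.2 + L) * R p.1 + 1
  let sums : ℕ × ℕ × ℕ → List (Fin m → ℤ × ℕ) := fun p =>
    (wordSums (predecessors A) zero pointAdd (val (p.1, p.2.2)) p.2.1 (N (p.1, p.2.1))).map Prod.snd
  let out : ℕ × ℕ × ℕ → List ((Fin m → ℤ × ℕ) × ℤ) := fun p =>
    (listSums zero pointAdd (sums p) (R p.1 * R p.1)).map fun q =>
      (pointDiv q (R p.1 * R p.1 * N (p.1, p.2.1)), (p.1 : ℤ))
  have hpow : Primrec fun n : ℕ => 2 ^ n :=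
    (Primrec.nat_rec₁ 1 (Primrec.nat_mul.comp Primrec.snd (Primrec.const 2)).to₂).of_eq fun n => by
      induction n with
      | zero => rfl
      | succ n ih => rw [pow_succ, ← ih]
  have hRp : Primrec R := Primrec.nat_mul.comp (Primrec.const M) (hpow.comp Primrec.succ)
  have hNp : Primrec N := Primrec.succ.comp (Primrec.nat_mul.comp
    (Primrec.nat_add.comp Primrec.snd (Primrec.const L)) (hRp.comp Primrec.fst))
  have hvalp : Primrec₂ val :=
    Primrec.option_getD.comp (primrec_wordValue _ e) (Primrec.const zero)
  have h21 : Primrec fun p : ℕ × ℕ × ℕ => p.2.1 := Primrec.fst.comp Primrec.snd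
  have hN' : Primrec fun p : ℕ × ℕ × ℕ => N (p.1, p.2.1) := hNp.comp (Primrec.pair Primrec.fst h21)
  have hRR : Primrec fun p : ℕ × ℕ × ℕ => R p.1 * R p.1 :=
    Primrec.nat_mul.comp (hRp.comp Primrec.fst) (hRp.comp Primrec.fst)
  have hsums : Primrec sums := by
    refine Primrec.list_map (primrec_wordSums (predecessors A) primrec_pointAdd
      (val := fun p : ℕ × ℕ × ℕ => val (p.1, p.2.2)) ?_ h21 hN') (Primrec.snd.comp Primrec.snd).to₂
    exact hvalp.comp (Primrec.pair (Primrec.fst.comp Primrec.fst)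
      (Primrec.snd.comp (Primrec.snd.comp Primrec.fst))) Primrec.snd
  have hout : Primrec out :=
    Primrec.list_map (primrec_listSums primrec_pointAdd hsums hRR)
      (Primrec.pair (primrec_pointDiv.comp Primrec.snd
        ((Primrec.nat_mul.comp hRR hN').comp Primrec.fst))
        (Primrec.int_ofNat.comp (Primrec.fst.comp Primrec.fst))).to₂
  refine ⟨fun n => out (n + 3, r (n + 3)),
    hout.to_comp.comp (Computable.pair (Computable.succ.comp (Computable.succ.comp Computable.succ))
      (hr.comp (Computable.succ.comp (Computable.succ.comp Computable.succ)))), fun n => ?_⟩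
  set k := (r (n + 3)).1 with hk
  set s := (r (n + 3)).2 with hs
  set δ : ℝ := (1 / 2) ^ (n + 3) with hδ
  have hδ0 : 0 < δ := by positivity
  set g : List (Fin d) → EuclideanSpace ℝ (Fin m) := fun w => ratPoint m (val (n + 3, s) w)
  have hg : ∀ x : sftSpace A, ‖g (initialWord x.1 k) - Φ x‖ ≤ δ := fun x => by
    obtain ⟨q, hq⟩ := Option.isSome_iff_exists.1 (hrs (n + 3) _ (mem_wordList.2 ⟨x, rfl⟩))
    have := dist_lt_of_wordValue hc he hq
    rw [dist_eq_norm] at this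
    -- The search succeeded on every admissible word, so the default `zero` in `val` does not occur
    -- here.
    simpa only [g, val, hk, hs, hq, Option.getD_some] using this.le
  have hR1 : 1 ≤ R (n + 3) := Nat.one_le_iff_ne_zero.2 (by positivity)
  have hN1 : 1 ≤ N (n + 3, k) := Nat.le_add_left _ _
  have hRδ : (R (n + 3) : ℝ) * δ = 2 * M := by
    simp only [R, hδ]
    push_cast
    rw [pow_succ _ (n + 3), one_div, inv_pow]
    field_simp
  have hNδ : 2 * ((k : ℝ) + L) * M ≤ (N (n + 3, k) : ℝ) * δ := by
    have : (N (n + 3, k) : ℝ) * δ = (k + L) * (R (n + 3) * δ) + δ := by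
      simp only [N]
      push_cast
      ring
    rw [this, hRδ]
    linarith
  have hball : (2 : ℝ) ^ (-((n + 3 : ℕ) : ℤ)) = δ := by
    rw [zpow_neg, zpow_natCast, hδ, one_div, inv_pow]
  have hmem : ∀ {t}, t ∈ sums (n + 3, r (n + 3)) → ∃ x : sftSpace A, ratPoint m t =
      ∑ i ∈ Finset.range (N (n + 3, k)), g (initialWord ((sftShift A)^[i] x).1 k) := by
    intro t ht
    obtain ⟨⟨w, t⟩, hp, rfl⟩ := List.mem_map.1 ht
    obtain ⟨x, rfl⟩ := exists_initialWord_of_mem_wordSums hp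
    exact ⟨x, point_of_mem_wordSums (ratPoint_zero m) ratPoint_pointAdd x hp⟩
  -- A point of a ball is within `δ` of its centre, which is within `2 δ` of the rotation set. The
  -- total `3 δ` is `3/8` of `2⁻ⁿ`, which explains the precision `n + 3`.
  refine lt_of_le_of_lt (Metric.hausdorffEDist_le_of_mem_edist (r := ENNReal.ofReal (3 * δ))
    ?_ ?_) ?_
  · intro y hy
    simp only [mem_iUnion] at hy
    obtain ⟨p, hp, hy⟩ := hy
    obtain ⟨t, ht, rfl⟩ := List.mem_map.1 hp
    obtain ⟨u, hu, hsum⟩ := point_of_mem_listSums (ratPoint_zero m) ratPoint_pointAdd ht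
    obtain ⟨w, hw, hdw⟩ := exists_mem_rotationSet_average_near (Φ := Φ) (Q := R (n + 3) * R (n + 3))
      (v := fun j => ratPoint m (u j)) hN1 (Nat.mul_pos hR1 hR1) (η := 2 * δ) fun j hj => by
        obtain ⟨x, hx⟩ := hmem (hu j hj)
        rw [hx]
        exact exists_mem_rotationSet_near hL hg hM hN1 hNδ x
    refine ⟨w, hw, ?_⟩
    rw [edist_dist]
    refine ENNReal.ofReal_le_ofReal ?_
    rw [Metric.mem_closedBall, hball, ratPoint_pointDiv _ (Nat.mul_pos (Nat.mul_pos hR1 hR1) hN1),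
      hsum] at hy
    exact (dist_triangle _ _ _).trans ((add_le_add hy hdw).trans_eq (by ring))
  · intro y hy
    obtain ⟨x, hx⟩ := exists_average_near_of_mem_rotationSet hg hM hN1 hR1 hRδ.ge hy
    choose u hu using fun j => exists_mem_wordSums (zero := zero) (add := pointAdd)
      (val (n + 3, s)) k (N (n + 3, k)) (x j)
    obtain ⟨t, ht, hsum⟩ := exists_mem_listSums (ratPoint_zero m) ratPoint_pointAdd
      (S := sums (n + 3, r (n + 3))) (u := u) (fun j => List.mem_map.2 ⟨_, hu j, rfl⟩)
      (R (n + 3) * R (n + 3))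
    refine ⟨_, mem_iUnion₂.2 ⟨_, List.mem_map.2 ⟨t, ht, rfl⟩,
      Metric.mem_closedBall_self (by positivity)⟩, ?_⟩
    rw [edist_dist]
    refine ENNReal.ofReal_le_ofReal ?_
    dsimp only
    rw [ratPoint_pointDiv _ (Nat.mul_pos (Nat.mul_pos hR1 hR1) hN1), hsum]
    simp only [fun j => point_of_mem_wordSums (ratPoint_zero m) ratPoint_pointAdd _ (hu j)]
    linarith
  · refine (ENNReal.ofReal_lt_ofReal_iff (by positivity)).2 ?_
    rw [hδ, pow_add]
    have : (0 : ℝ) < (1 / 2) ^ n := by positivity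
    norm_num
    linarith
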